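/- Let $K^k_N$ denote the complete $k$-uniform hypergraph on the ordered vertex set $\{1,\dots,N\}$. A monotone path of length $n$ in $K^k_N$ consists of the $n$ edges $\{x_i,x_{i+1},\dots,x_{i+k-1}\}$, $1\le i\le n$, for some vertices $x_1<x_2<\dots<x_{n+k-1}$. Let $N_k(q,n)$ be the smallest integer $N$ such that every coloring of the edges of $K^k_N$ with $q$ colors contains a monochromatic monotone path of length $n$. For a real number $x$ let $t_1(x)=x$ and $t_{j+1}(x)=2^{t_j(x)}$ for $j\ge 1$ (a tower of exponents of height $j$ with $x$ at the top). Theorem. There is an absolute constant $n_0$ such that for every $k\ge 3$, $q\ge 2$ and $n\ge n_0$, the number $N_k(q,n)$ is well defined (that is, an integer $N$ with the above property exists) and $$N_k(q,n)\ \ge\ t_{k-2}\!\left(\frac{N_3(q,n)}{3\,n^{q}}\right).$$ -/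

import Mathlib

namespace MonoPath

/-- The edges of the complete `k`-uniform hypergraph on the ordered vertex set `Fin N`
(the `N` vertices `0 < 1 < ⋯ < N - 1`): all `k`-element sets of vertices. -/
abbrev Edge (k N : ℕ) : Type := {e : Finset (Fin N) // e.card = k}

/-- A monotone path of length `n` is given by vertices `x 0 < x 1 < ⋯ < x (n + k - 2)`.
Its `i`-th edge (`i < n`) is `{x i, x (i + 1), …, x (i + k - 1)}`. -/
def pathEdge {k n N : ℕ} (x : Fin (n + k - 1) ↪o Fin N) (i : Fin n) : Edge k N :=
  ⟨Finset.univ.map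
    ⟨fun j : Fin k => x ⟨i.val + j.val, by omega⟩, fun a b h => by
      have h' := congrArg Fin.val (x.injective h)
      simp only [Nat.add_left_cancel_iff] at h'
      exact Fin.ext h'⟩,
    by simp⟩

/-- The coloring `c` of the edges of the complete `k`-uniform hypergraph on `N` vertices
contains a monochromatic monotone path of length (number of edges) `n`. -/
def HasMonoPath {k q N : ℕ} (c : Edge k N → Fin q) (n : ℕ) : Prop :=
  ∃ (x : Fin (n + k - 1) ↪o Fin N) (a : Fin q), ∀ i : Fin n, c (pathEdge x i) = a

/-- The integers `N` such that every `q`-coloring of the edges of the complete `k`-uniform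
hypergraph on `N` vertices contains a monochromatic monotone path of length `n`. -/
def forcing (k q n : ℕ) : Set ℕ :=
  {N | ∀ c : Edge k N → Fin q, HasMonoPath c n}

/-- `N_k(q,n)`: the smallest element of `forcing k q n`. -/
noncomputable def ramseyN (k q n : ℕ) : ℕ := sInf (forcing k q n)

/-- `t_k(x)` for `k ≥ 1`: `t_1(x) = x` and `t_{k+1}(x) = 2 ^ t_k(x)`, the tower with `k - 1`
twos and `x` at the top. -/
noncomputable def tower (k : ℕ) (x : ℝ) : ℝ := (fun y : ℝ => (2 : ℝ) ^ y)^[k - 1] x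

end MonoPath

namespace MonoPath

/-! A colouring of edges without a monochromatic path of length n amounts to labelling shorter
tuples by the grid [n]^q so that labels never weakly decrease under the shift: record for each
colour the longest path ending at the tuple (`notMem_forcing_iff`). Tuples can be shortened by one
vertex at the price of replacing the poset by its lower sets (`shiftLabelling_lowerSet`,
`shiftLabelling_of_lowerSet`), until only the size of the poset matters. So N_3 - 1 is at most the
number of lower sets of the grid, of which a fraction 1/(n^q + 1) forms an antichain. Each further
passage to lower sets makes an antichain of size w into one of size C(w, w/2), roughly 2^w, which
builds the tower. -/

/-! ### Shift labellings and lower sets -/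

/-- There is a labelling of the `k`-tuples of vertices in `Fin N` by elements of `P` such that
the label of the tail of an increasing `(k + 1)`-tuple is never below the label of its initial
segment. -/
def ShiftLabelling (k N : ℕ) (P : Type*) [LE P] : Prop :=
  ∃ f : (Fin k → Fin N) → P, ∀ x : Fin (k + 1) → Fin N, StrictMono x →
    ¬ f (Fin.tail x) ≤ f (Fin.init x)

theorem strictMono_tail {k N : ℕ} {x : Fin (k + 1) → Fin N} (hx : StrictMono x) :
    StrictMono (Fin.tail x) := fun _ _ h => hx (Fin.succ_lt_succ_iff.2 h)

theorem strictMono_init {k N : ℕ} {x : Fin (k + 1) → Fin N} (hx : StrictMono x) :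
    StrictMono (Fin.init x) := fun _ _ h => hx (Fin.castSucc_lt_castSucc_iff.2 h)

theorem ShiftLabelling.mono {k N N' : ℕ} {P : Type*} [LE P] (h : ShiftLabelling k N P)
    (hN : N' ≤ N) : ShiftLabelling k N' P := by
  obtain ⟨f, hf⟩ := h
  refine ⟨fun y => f (Fin.castLE hN ∘ y), fun x hx => ?_⟩
  exact hf (Fin.castLE hN ∘ x) ((Fin.strictMono_castLE hN).comp hx)

/-- Label y by the down-closure of the labels of tuples with tail y. An inclusion yields x, z
overlapping in all but one vertex with f z ≤ f x; gluing them gives a forbidden longer tuple. -/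
theorem shiftLabelling_lowerSet {k N : ℕ} {P : Type*} [PartialOrder P]
    (h : ShiftLabelling (k + 2) N P) : ShiftLabelling (k + 1) N (LowerSet P) := by
  obtain ⟨f, hf⟩ := h
  refine ⟨fun y => lowerClosure {p | ∃ x, StrictMono x ∧ Fin.tail x = y ∧ f x = p},
    fun z hz hle => ?_⟩
  have hmem : f z ∈ lowerClosure {p | ∃ x, StrictMono x ∧ Fin.tail x = Fin.init z ∧ f x = p} :=
    hle (subset_lowerClosure ⟨z, hz, rfl, rfl⟩)
  obtain ⟨_, ⟨x, hx, hxz, rfl⟩, hzx⟩ := mem_lowerClosure.1 hmem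
  have hz0 : x 1 = z 0 := congrFun hxz 0
  have hcons : StrictMono (Fin.cons (x 0) z : Fin (k + 3) → Fin N) := by
    rw [Fin.strictMono_iff_lt_succ]
    intro i
    refine Fin.cases ?_ (fun j => ?_) i
    · have : x 0 < x 1 := hx (by simp)
      simpa [hz0] using this
    · rw [Fin.castSucc_succ, Fin.cons_succ, Fin.cons_succ]
      exact hz (Fin.castSucc_lt_succ)
  refine hf _ hcons ?_
  have hinit : Fin.init (Fin.cons (x 0) z : Fin (k + 3) → Fin N) = x := by
    funext i
    refine Fin.cases ?_ (fun j => ?_) i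
    · rfl
    · exact (congrFun hxz j).symm
  rw [Fin.tail_cons, hinit]
  exact hzx

/-- Label z by a witness of the non-inclusion. Since `tail (init x) = init (tail x)`, a comparison
would put the witness of the tail into the lower set it was chosen to avoid. -/
theorem shiftLabelling_of_lowerSet {k N : ℕ} {P : Type*} [PartialOrder P] [Nonempty P]
    (h : ShiftLabelling (k + 1) N (LowerSet P)) : ShiftLabelling (k + 2) N P := by
  obtain ⟨g, hg⟩ := h
  have hex : ∀ z : Fin (k + 2) → Fin N, ∃ p : P,
      StrictMono z → p ∈ g (Fin.tail z) ∧ p ∉ g (Fin.init z) := by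
    intro z
    by_cases hz : StrictMono z
    · obtain ⟨p, hp, hp'⟩ := Set.not_subset.1 (hg z hz)
      exact ⟨p, fun _ => ⟨hp, hp'⟩⟩
    · exact ⟨Classical.arbitrary P, fun h => absurd h hz⟩
  choose f hf using hex
  refine ⟨f, fun x hx hle => ?_⟩
  exact (hf _ (strictMono_tail hx)).2
    ((g (Fin.tail (Fin.init x))).lower hle (hf _ (strictMono_init hx)).1)

theorem shiftLabelling_one_iff {N : ℕ} {P : Type*} [PartialOrder P] [Finite P] :
    ShiftLabelling 1 N P ↔ N ≤ Nat.card P := by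
  have := Fintype.ofFinite P
  constructor
  · rintro ⟨f, hf⟩
    have key : ∀ a b : Fin N, a < b → f (fun _ => a) ≠ f (fun _ => b) := by
      intro a b hab heq
      have hx : StrictMono ![a, b] := by
        rw [Fin.strictMono_iff_lt_succ]
        intro i
        fin_cases i
        exact hab
      refine hf _ hx (le_of_eq ?_)
      have h1 : Fin.tail ![a, b] = fun _ => b := by funext i; fin_cases i; rfl
      have h2 : Fin.init ![a, b] = fun _ => a := by funext i; fin_cases i; rfl
      rw [h1, h2, heq]
    have hinj : Function.Injective fun a : Fin N => f (fun _ => a) := by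
      intro a b hab
      rcases lt_trichotomy a b with h | h | h
      · exact absurd hab (key a b h)
      · exact h
      · exact absurd hab.symm (key b a h)
    simpa using Nat.card_le_card_of_injective _ hinj
  · intro hN
    have : Fintype (LinearExtension P) := inferInstanceAs (Fintype P)
    have hcard : Fintype.card (LinearExtension P) = Nat.card P :=
      (Nat.card_eq_fintype_card (α := LinearExtension P)).symm
    let e : Fin (Nat.card P) ≃o LinearExtension P := Fintype.orderIsoFinOfCardEq _ hcard
    let r : Fin N → P := fun a => e (Fin.castLE hN a)
    refine ⟨fun y => r (y 0), fun x hx hle => ?_⟩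
    have h1 : e (Fin.castLE hN (x 1)) ≤ e (Fin.castLE hN (x 0)) :=
      (toLinearExtension (α := P)).monotone hle
    have h2 : x 1 ≤ x 0 := e.le_iff_le.1 h1
    exact absurd (hx (show (0 : Fin 2) < 1 by simp)) (not_lt.2 h2)

/-! ### Colourings versus shift labellings -/

/-- The edge spanned by an increasing tuple of vertices. -/
def edgeOf {k N : ℕ} (z : Fin k → Fin N) (hz : StrictMono z) : Edge k N :=
  ⟨Finset.univ.map ⟨z, hz.injective⟩, by simp⟩

theorem orderEmbOfFin_edgeOf {k N : ℕ} (z : Fin k → Fin N) (hz : StrictMono z) :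
    ⇑((edgeOf z hz).1.orderEmbOfFin (edgeOf z hz).2) = z :=
  (Finset.orderEmbOfFin_unique _ (fun i => by simp [edgeOf]) hz).symm

/-- Colour an edge by a coordinate in which its label increases. A monochromatic path of length n
would give n + 1 increasing values in `Fin n`. -/
theorem notMem_forcing_of_shiftLabelling {j q n N : ℕ}
    (h : ShiftLabelling j N (Fin q → Fin n)) : N ∉ forcing (j + 1) q n := by
  obtain ⟨f, hf⟩ := h
  intro hforce
  have hex : ∀ e : Edge (j + 1) N, ∃ a : Fin q,
      f (Fin.init (e.1.orderEmbOfFin e.2)) a < f (Fin.tail (e.1.orderEmbOfFin e.2)) a := by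
    intro e
    have := hf _ (e.1.orderEmbOfFin e.2).strictMono
    simpa [Pi.le_def] using this
  choose c hc using hex
  obtain ⟨x, a, hx⟩ := hforce c
  let p : ℕ → Fin n := fun i =>
    if h : i ≤ n then f (fun t : Fin j => x ⟨i + t.1, by omega⟩) a
    else f (fun t : Fin j => x ⟨t.1, by omega⟩) a
  have hp : ∀ i, i < n → p i < p (i + 1) := by
    intro i hi
    have hz : StrictMono fun t : Fin (j + 1) => x ⟨i + t.1, by omega⟩ := by
      intro s t hst
      apply x.strictMono
      simpa using hst
    have h1 := hc (edgeOf _ hz)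
    have h2 : c (edgeOf _ hz) = a := hx ⟨i, hi⟩
    rw [orderEmbOfFin_edgeOf, h2] at h1
    have e1 : p i = f (fun t : Fin j => x ⟨i + t.1, by omega⟩) a := dif_pos hi.le
    have e2 : p (i + 1) = f (fun t : Fin j => x ⟨i + 1 + t.1, by omega⟩) a := dif_pos hi
    have e3 : (fun t : Fin j => x ⟨i + 1 + t.1, by omega⟩) =
        Fin.tail fun t : Fin (j + 1) => x ⟨i + t.1, by omega⟩ :=
      funext fun t => congrArg x (Fin.ext (by simp only [Fin.val_succ]; omega))
    rw [e1, e2, e3]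
    exact h1
  have hge : ∀ i, i ≤ n → i ≤ (p i).1 := by
    intro i
    induction i with
    | zero => simp
    | succ i ih =>
      intro hi
      have h1 := ih (by omega)
      have h2 : (p i).1 < (p (i + 1)).1 := hp i (by omega)
      omega
  exact absurd (hge n le_rfl) (not_le.2 (p n).2)

/-- The tuple `y` is the end of a monotone path of length `l` all of whose edges get color `a`. -/
def EndsPath {j N q : ℕ} (c : Edge (j + 1) N → Fin q) (a : Fin q) :
    ℕ → (Fin j → Fin N) → Prop
  | 0, _ => True
  | l + 1, y => ∃ (z : Fin (j + 1) → Fin N) (hz : StrictMono z),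
      Fin.tail z = y ∧ c (edgeOf z hz) = a ∧ EndsPath c a l (Fin.init z)

theorem EndsPath.exists_path {j N q : ℕ} {c : Edge (j + 2) N → Fin q} {a : Fin q} (l : ℕ) :
    ∀ y : Fin (j + 1) → Fin N, StrictMono y → EndsPath c a l y →
    ∃ p : ℕ → Fin N, (∀ s t, s < t → t < l + (j + 1) → p s < p t) ∧
      (∀ t : Fin (j + 1), p (l + t) = y t) ∧
      ∀ i < l, ∀ h : StrictMono fun t : Fin (j + 2) => p (i + t), c (edgeOf _ h) = a := by
  induction l with
  | zero =>
    intro y hy _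
    refine ⟨fun t => if h : t < j + 1 then y ⟨t, h⟩ else y 0, ?_, ?_, ?_⟩
    · intro s t hst ht
      have ht' : t < j + 1 := by omega
      simp only [ht', hst.trans ht', dif_pos]
      exact hy hst
    · intro t
      rw [Nat.zero_add]
      exact dif_pos t.2
    · intro i hi
      omega
  | succ l ih =>
    rintro _ hy ⟨z, hz, rfl, hcz, hl⟩
    obtain ⟨p, hp, hpe, hpc⟩ := ih _ (strictMono_init hz) hl
    let p' : ℕ → Fin N := Function.update p (l + (j + 1)) (z (Fin.last _))
    have hlt : ∀ t, t < l + (j + 1) → p' t = p t := fun t ht =>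
      Function.update_of_ne (by omega) _ _
    have hz' : ∀ t : Fin (j + 2), p' (l + t) = z t := by
      intro t
      refine Fin.lastCases ?_ (fun t => ?_) t
      · exact Function.update_self _ _ _
      · rw [hlt _ (by rw [Fin.val_castSucc]; omega)]
        exact hpe t
    refine ⟨p', ?_, ?_, ?_⟩
    · intro s t hst ht
      by_cases h : t < l + (j + 1)
      · rw [hlt _ h, hlt _ (hst.trans h)]
        exact hp s t hst h
      · have ht' : t = l + (j + 1) := by omega
        have h1 : p' s ≤ p' (l + j) := by
          rw [hlt s (by omega), hlt (l + j) (by omega)]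
          rcases (show s ≤ l + j by omega).eq_or_lt with rfl | h
          · exact le_rfl
          · exact (hp _ _ h (by omega)).le
        -- The appended vertex need only exceed its predecessor, the next-to-last entry of z.
        have h2 : p' (l + j) < p' t := by
          subst ht'
          have e1 := hz' ⟨j, by omega⟩
          have e2 := hz' ⟨j + 1, by omega⟩
          simp only at e1 e2
          rw [e1, e2]
          exact hz (by simp)
        exact h1.trans_lt h2
    · intro t
      have := hz' t.succ
      rw [Fin.val_succ, show l + (t.1 + 1) = l + 1 + t.1 by omega] at this
      exact this
    · intro i hi h
      rcases (show i ≤ l by omega).eq_or_lt with rfl | hil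
      · have e : (fun t : Fin (j + 2) => p' (i + t)) = z := funext hz'
        simp only [e]
        exact hcz
      · have e : (fun t : Fin (j + 2) => p' (i + t)) = fun t : Fin (j + 2) => p (i + t) :=
          funext fun t => hlt _ (by omega)
        have := hpc i hil (by rw [← e]; exact h)
        simp only [e]
        exact this

theorem EndsPath.hasMonoPath {j N q n : ℕ} {c : Edge (j + 2) N → Fin q} {a : Fin q}
    {y : Fin (j + 1) → Fin N} (hy : StrictMono y) (h : EndsPath c a n y) : HasMonoPath c n := by
  obtain ⟨p, hp, -, hpc⟩ := EndsPath.exists_path n y hy h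
  refine ⟨OrderEmbedding.ofStrictMono (fun t => p t) (fun s t hst => hp s t hst (by omega)), a,
    fun i => ?_⟩
  exact hpc i i.2 fun s t hst => hp _ _ (by simpa using hst) (by omega)

theorem shiftLabelling_of_notMem_forcing {j q n N : ℕ} (hn : 0 < n)
    (h : N ∉ forcing (j + 2) q n) : ShiftLabelling (j + 1) N (Fin q → Fin n) := by
  classical
  rw [forcing, Set.mem_ofPred_eq, not_forall] at h
  obtain ⟨c, hc⟩ := h
  -- Longest path of colour a ending at y, capped at n - 1; exceeding the cap would yield a path of
  -- length n.
  refine ⟨fun y a => ⟨Nat.findGreatest (fun l => EndsPath c a l y) (n - 1), by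
    have := Nat.findGreatest_le (P := fun l => EndsPath c a l y) (n - 1)
    omega⟩, fun z hz hle => ?_⟩
  have h1 := hle (c (edgeOf z hz))
  rw [Fin.mk_le_mk] at h1
  set a := c (edgeOf z hz) with ha
  set l := Nat.findGreatest (fun l => EndsPath c a l (Fin.init z)) (n - 1) with hl
  have hll : l ≤ n - 1 := Nat.findGreatest_le _
  have hend : EndsPath c a l (Fin.init z) :=
    Nat.findGreatest_spec (P := fun l => EndsPath c a l (Fin.init z)) (Nat.zero_le _) trivial
  have hend' : EndsPath c a (l + 1) (Fin.tail z) := ⟨z, hz, rfl, ha.symm, hend⟩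
  rcases Nat.lt_or_ge l (n - 1) with h | h
  · have := Nat.le_findGreatest (P := fun l => EndsPath c a l (Fin.tail z))
      (show l + 1 ≤ n - 1 from h) hend'
    omega
  · have e : l + 1 = n := by omega
    rw [e] at hend'
    exact hc (hend'.hasMonoPath (strictMono_tail hz))

theorem notMem_forcing_iff {j q n N : ℕ} (hn : 0 < n) :
    N ∉ forcing (j + 2) q n ↔ ShiftLabelling (j + 1) N (Fin q → Fin n) :=
  ⟨shiftLabelling_of_notMem_forcing hn, notMem_forcing_of_shiftLabelling⟩

/-- Lower sets of a finite poset are finite in number, so reduction to single vertices bounds N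
without Ramsey's theorem. -/
theorem exists_not_shiftLabelling (k : ℕ) : ∀ (P : Type) [PartialOrder P] [Finite P],
    ∃ N, ¬ ShiftLabelling (k + 1) N P := by
  induction k with
  | zero =>
    intro P _ _
    exact ⟨Nat.card P + 1, fun h => by have := shiftLabelling_one_iff.1 h; omega⟩
  | succ k ih =>
    intro P _ _
    obtain ⟨N, hN⟩ := ih (LowerSet P)
    exact ⟨N, fun h => hN (shiftLabelling_lowerSet h)⟩

theorem forcing_nonempty {j q n : ℕ} (hn : 0 < n) : (forcing (j + 2) q n).Nonempty := by
  obtain ⟨N, hN⟩ := exists_not_shiftLabelling j (Fin q → Fin n)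
  exact ⟨N, not_not.1 fun h => hN ((notMem_forcing_iff hn).1 h)⟩

theorem lt_ramseyN {j q n N : ℕ} (hn : 0 < n)
    (h : ShiftLabelling (j + 1) N (Fin q → Fin n)) : N < ramseyN (j + 2) q n := by
  by_contra! hle
  exact (notMem_forcing_iff hn).2 (h.mono hle) (Nat.sInf_mem (forcing_nonempty hn))

theorem ramseyN_three_le {q n : ℕ} (hn : 0 < n) :
    ramseyN 3 q n ≤ Nat.card (LowerSet (Fin q → Fin n)) + 1 := by
  refine Nat.sInf_le (not_not.1 fun h => ?_)
  have := shiftLabelling_one_iff.1 (shiftLabelling_lowerSet ((notMem_forcing_iff (j := 1) hn).1 h))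
  omega

/-! ### Antichains of lower sets -/

theorem lowerClosure_le_lowerClosure_iff {P : Type*} [PartialOrder P] {s T T' : Set P}
    (hs : IsAntichain (· ≤ ·) s) (hT : T ⊆ s) (hT' : T' ⊆ s) :
    lowerClosure T ≤ lowerClosure T' ↔ T ⊆ T' := by
  refine ⟨fun h p hp => ?_, fun h => lowerClosure_mono h⟩
  obtain ⟨r, hr, hpr⟩ := mem_lowerClosure.1 (h (subset_lowerClosure hp))
  rwa [hs.eq (hT hp) (hT' hr) hpr]

theorem two_pow_card_le_card_lowerSet {P : Type*} [PartialOrder P] [Finite P] {s : Finset P}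
    (hs : IsAntichain (· ≤ ·) (s : Set P)) : 2 ^ s.card ≤ Nat.card (LowerSet P) := by
  have := Fintype.ofFinite (LowerSet P)
  rw [← Finset.card_powerset, Nat.card_eq_fintype_card, ← Finset.card_univ]
  refine Finset.card_le_card_of_injOn (fun T => lowerClosure (T : Set P)) (by simp) ?_
  intro T hT T' hT' h
  have hT : (T : Set P) ⊆ s := by simpa using hT
  have hT' : (T' : Set P) ⊆ s := by simpa using hT'
  exact_mod_cast ((lowerClosure_le_lowerClosure_iff hs hT hT').1 h.le).antisymm
    ((lowerClosure_le_lowerClosure_iff hs hT' hT).1 h.ge)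

theorem exists_antichain_lowerSet {P : Type*} [PartialOrder P] {s : Finset P}
    (hs : IsAntichain (· ≤ ·) (s : Set P)) :
    ∃ S : Finset (LowerSet P), IsAntichain (· ≤ ·) (S : Set (LowerSet P)) ∧
      S.card = s.card.choose (s.card / 2) := by
  classical
  have hsub : ∀ T ∈ Finset.powersetCard (s.card / 2) s, (T : Set P) ⊆ s := fun T hT => by
    exact_mod_cast (Finset.mem_powersetCard.1 hT).1
  have key : ∀ T ∈ Finset.powersetCard (s.card / 2) s, ∀ T' ∈ Finset.powersetCard (s.card / 2) s,
      lowerClosure (T : Set P) ≤ lowerClosure (T' : Set P) → T = T' := by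
    intro T hT T' hT' h
    have h' := (lowerClosure_le_lowerClosure_iff hs (hsub T hT) (hsub T' hT')).1 h
    refine Finset.eq_of_subset_of_card_le (by exact_mod_cast h') ?_
    rw [(Finset.mem_powersetCard.1 hT).2, (Finset.mem_powersetCard.1 hT').2]
  refine ⟨(Finset.powersetCard (s.card / 2) s).image fun T : Finset P => lowerClosure (T : Set P), ?_, ?_⟩
  · rintro a ha b hb hab hle
    obtain ⟨T, hT, rfl⟩ := Finset.mem_image.1 (Finset.mem_coe.1 ha)
    obtain ⟨T', hT', rfl⟩ := Finset.mem_image.1 (Finset.mem_coe.1 hb)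
    exact hab (by rw [key T hT T' hT' hle])
  · rw [Finset.card_image_of_injOn fun T hT T' hT' h => key T hT T' hT' (le_of_eq h),
      Finset.card_powersetCard]

/-- Lower sets of equal cardinality form an antichain; take the most frequent of the |P| + 1 sizes.
-/
theorem exists_antichain_lowerSet_of_card {P : Type*} [PartialOrder P] [Finite P] :
    ∃ S : Finset (LowerSet P), IsAntichain (· ≤ ·) (S : Set (LowerSet P)) ∧
      Nat.card (LowerSet P) ≤ (Nat.card P + 1) * S.card := by
  classical
  have := Fintype.ofFinite P
  have := Fintype.ofFinite (LowerSet P)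
  by_contra! h
  let lev : ℕ → Finset (LowerSet P) := fun i =>
    Finset.univ.filter fun A => (A : Set P).ncard = i
  have hanti : ∀ i, IsAntichain (· ≤ ·) (lev i : Set (LowerSet P)) := by
    intro i A hA B hB hne hle
    have hA : (A : Set P).ncard = i := by simpa [lev] using hA
    have hB : (B : Set P).ncard = i := by simpa [lev] using hB
    exact hne (SetLike.coe_injective (Set.eq_of_subset_of_ncard_le hle (by rw [hA, hB])))
  have hmaps : ∀ A ∈ (Finset.univ : Finset (LowerSet P)),
      (A : Set P).ncard ∈ Finset.range (Nat.card P + 1) := by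
    intro A _
    rw [Finset.mem_range, Nat.lt_succ_iff]
    exact Set.ncard_le_card _
  have hsum := Finset.card_eq_sum_card_fiberwise hmaps
  have hne : (Finset.range (Nat.card P + 1)).Nonempty := by simp
  obtain ⟨m, -, hm⟩ := Finset.exists_max_image _ (fun i => (lev i).card) hne
  have hle : ∑ i ∈ Finset.range (Nat.card P + 1), (lev i).card
      ≤ (Nat.card P + 1) * (lev m).card := by
    simpa using Finset.sum_le_card_nsmul _ _ _ hm
  have := h (lev m) (hanti m)
  rw [Nat.card_eq_fintype_card (α := LowerSet P), ← Finset.card_univ, hsum] at this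
  exact absurd hle (not_le.2 this)

theorem four_mul_two_pow_le_choose_sq {w : ℕ} (hw : 10 ≤ w) :
    4 * 2 ^ w ≤ w.choose (w / 2) ^ 2 := by
  have h1 : 2 ^ w ≤ (w + 1) * w.choose (w / 2) := by
    rw [← Nat.sum_range_choose]
    simpa using Finset.sum_le_card_nsmul (Finset.range (w + 1)) _ _
      fun i _ => Nat.choose_le_middle i w
  have h2 : 4 * (w + 1) ^ 2 ≤ 2 ^ w := by
    clear h1
    induction w, hw using Nat.le_induction with
    | base => norm_num
    | succ w hw ih =>
      rw [pow_succ 2]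
      nlinarith
  have h3 : (2 ^ w) ^ 2 ≤ ((w + 1) * w.choose (w / 2)) ^ 2 := Nat.pow_le_pow_left h1 2
  have h4 : 0 < (w + 1) ^ 2 := by positivity
  refine Nat.le_of_mul_le_mul_left ?_ h4
  calc (w + 1) ^ 2 * (4 * 2 ^ w) = 4 * (w + 1) ^ 2 * 2 ^ w := by ring
    _ ≤ 2 ^ w * 2 ^ w := Nat.mul_le_mul_right _ h2
    _ = (2 ^ w) ^ 2 := by ring
    _ ≤ _ := h3
    _ = _ := by ring

/-- The factor 2 in 2x ≤ w makes the induction close: C(w, w/2)² ≥ 4·2^w gives 2·2^x ≤ C(w, w/2),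
the same hypothesis for 2^x. -/
theorem exists_shiftLabelling_tower_le (m : ℕ) :
    ∀ (Q : Type) [PartialOrder Q] [Finite Q] [Nonempty Q] (s : Finset Q) (x : ℝ),
    IsAntichain (· ≤ ·) (s : Set Q) → 10 ≤ s.card → 2 * x ≤ s.card →
    ∃ N : ℕ, tower (m + 2) x ≤ N ∧ ShiftLabelling (m + 2) N Q := by
  induction m with
  | zero =>
    intro Q _ _ _ s x hs _ hx
    refine ⟨Nat.card (LowerSet Q), ?_,
      shiftLabelling_of_lowerSet (shiftLabelling_one_iff.2 le_rfl)⟩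
    have h0 : (0 : ℝ) ≤ s.card := Nat.cast_nonneg _
    calc tower (0 + 2) x = (2 : ℝ) ^ x := rfl
      _ ≤ (2 : ℝ) ^ (s.card : ℝ) := Real.rpow_le_rpow_of_exponent_le one_le_two (by linarith)
      _ = ((2 ^ s.card : ℕ) : ℝ) := by rw [Real.rpow_natCast]; push_cast; rfl
      _ ≤ _ := Nat.cast_le.2 (two_pow_card_le_card_lowerSet hs)
  | succ m ih =>
    intro Q _ _ _ s x hs hs10 hx
    obtain ⟨S, hS, hcard⟩ := exists_antichain_lowerSet hs
    have hsq := four_mul_two_pow_le_choose_sq hs10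
    rw [← hcard] at hsq
    have h10 : 10 ≤ S.card := by
      have : 2 ^ 10 ≤ 2 ^ s.card := Nat.pow_le_pow_right (by norm_num) hs10
      nlinarith
    have hx' : 2 * (2 : ℝ) ^ x ≤ S.card := by
      refine le_of_sq_le_sq ?_ (Nat.cast_nonneg _)
      calc (2 * (2 : ℝ) ^ x) ^ 2 = 4 * (2 : ℝ) ^ (2 * x) := by
            rw [mul_comm 2 x, Real.rpow_mul (by norm_num), Real.rpow_two]; ring
        _ ≤ 4 * (2 : ℝ) ^ (s.card : ℝ) := by
            gcongr
            exact one_le_two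
        _ = ((4 * 2 ^ s.card : ℕ) : ℝ) := by rw [Real.rpow_natCast]; push_cast; rfl
        _ ≤ ((S.card ^ 2 : ℕ) : ℝ) := Nat.cast_le.2 hsq
        _ = _ := by push_cast; rfl
    obtain ⟨N, hN, hlab⟩ := ih (LowerSet Q) S (2 ^ x) hS h10 hx'
    exact ⟨N, hN, shiftLabelling_of_lowerSet hlab⟩

/-! ### The grid and the final estimate -/

theorem exists_antichain_grid {q n : ℕ} (hn : 0 < n) :
    ∃ s : Finset (Fin q → Fin n), IsAntichain (· ≤ ·) (s : Set (Fin q → Fin n)) ∧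
      s.card = n ^ (q / 2) := by
  classical
  -- Coordinates come in pairs (u, reversed u), so comparability forces equality; an odd leftover is
  -- 0.
  let e : (Fin (q / 2) → Fin n) → Fin q → Fin n := fun u i =>
    if h : i.1 / 2 < q / 2 then
      if i.1 % 2 = 0 then u ⟨i.1 / 2, h⟩ else (u ⟨i.1 / 2, h⟩).rev
    else ⟨0, hn⟩
  have he : ∀ u v, e u ≤ e v → u = v := by
    intro u v h
    funext i
    have h0 := h ⟨2 * i.1, by omega⟩
    have h1 := h ⟨2 * i.1 + 1, by omega⟩
    have d : (2 * i.1 + 1) / 2 = i.1 := by omega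
    have d' : (2 * i.1 + 1) % 2 = 1 := by omega
    simp only [e, d, d', Nat.mul_div_cancel_left _ two_pos, Nat.mul_mod_right, i.2, dif_pos,
      if_true, one_ne_zero, if_false, Fin.eta, Fin.rev_le_rev] at h0 h1
    exact le_antisymm h0 h1
  refine ⟨Finset.univ.image e, ?_, ?_⟩
  · rintro a ha b hb hab hle
    obtain ⟨u, -, rfl⟩ := Finset.mem_image.1 (Finset.mem_coe.1 ha)
    obtain ⟨v, -, rfl⟩ := Finset.mem_image.1 (Finset.mem_coe.1 hb)
    exact hab (by rw [he u v hle])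
  · rw [Finset.card_image_of_injective _ fun u v h => he u v h.le]
    simp

theorem ten_mul_cube_le_two_pow {y : ℕ} (hy : 16 ≤ y) : 10 * (y ^ 3 + 1) ≤ 2 ^ y := by
  induction y, hy using Nat.le_induction with
  | base => norm_num
  | succ y hy ih =>
    rw [pow_succ 2]
    have h1 : 16 * y ≤ y * y := Nat.mul_le_mul_right y hy
    have h2 : 16 * y * y ≤ y * y * y := Nat.mul_le_mul_right y h1
    nlinarith

theorem ten_mul_le_card_lowerSet_grid {q n : ℕ} (hq : 2 ≤ q) (hn : 16 ≤ n) :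
    10 * (n ^ q + 1) ≤ Nat.card (LowerSet (Fin q → Fin n)) := by
  obtain ⟨s, hs, hcard⟩ := exists_antichain_grid (q := q) (n := n) (by omega)
  have hy : 16 ≤ n ^ (q / 2) := hn.trans (Nat.le_self_pow (by omega) n)
  -- The cube suffices because q ≤ 3⌊q/2⌋ for q ≥ 2.
  have hpow : n ^ q ≤ (n ^ (q / 2)) ^ 3 := by
    rw [← pow_mul]
    exact Nat.pow_le_pow_right (by omega) (by omega)
  calc 10 * (n ^ q + 1) ≤ 10 * ((n ^ (q / 2)) ^ 3 + 1) := by gcongr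
    _ ≤ 2 ^ n ^ (q / 2) := ten_mul_cube_le_two_pow hy
    _ = 2 ^ s.card := by rw [hcard]
    _ ≤ _ := two_pow_card_le_card_lowerSet hs

theorem tower_le_ramseyN {m q n : ℕ} (hq : 2 ≤ q) (hn : 16 ≤ n) :
    tower (m + 2) ((ramseyN 3 q n : ℝ) / (3 * (n : ℝ) ^ q)) ≤ ramseyN (m + 4) q n := by
  have hn0 : 0 < n := by omega
  have : Nonempty (Fin n) := ⟨⟨0, hn0⟩⟩
  obtain ⟨S, hS, hcard⟩ := exists_antichain_lowerSet_of_card (P := Fin q → Fin n)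
  have hM := ten_mul_le_card_lowerSet_grid hq hn
  have hR := ramseyN_three_le (q := q) hn0
  have hP : Nat.card (Fin q → Fin n) = n ^ q := by simp
  rw [hP] at hcard
  have hp : 16 ≤ n ^ q := hn.trans (Nat.le_self_pow (by omega) n)
  have h10 : 10 ≤ S.card := by
    refine Nat.le_of_mul_le_mul_left ?_ (Nat.succ_pos (n ^ q))
    rw [Nat.succ_eq_add_one]
    linarith
  have hx : 2 * ((ramseyN 3 q n : ℝ) / (3 * (n : ℝ) ^ q)) ≤ S.card := by
    -- N_3 ≤ (n^q + 1)|S| + 1; doubled, this fits under 3n^q|S| since n^q ≥ 16 and |S| ≥ 10.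
    have hnat : 2 * ramseyN 3 q n ≤ S.card * (3 * n ^ q) := by nlinarith
    have hreal : (2 : ℝ) * ramseyN 3 q n ≤ S.card * (3 * (n : ℝ) ^ q) := by exact_mod_cast hnat
    rw [← mul_div_assoc, div_le_iff₀ (by positivity)]
    exact hreal
  obtain ⟨N, hN, hlab⟩ := exists_shiftLabelling_tower_le m _ S _ hS h10 hx
  exact hN.trans (Nat.cast_le.2 (lt_ramseyN hn0 (shiftLabelling_of_lowerSet hlab)).le)

end MonoPath

theorem mainTheorem4 :
    ∃ n₀ : ℕ, ∀ k q n : ℕ, 3 ≤ k → 2 ≤ q → n₀ ≤ n →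
      (MonoPath.forcing k q n).Nonempty ∧
      MonoPath.tower (k - 2) ((MonoPath.ramseyN 3 q n : ℝ) / (3 * (n : ℝ) ^ q))
        ≤ (MonoPath.ramseyN k q n : ℝ) := by
  refine ⟨16, fun k q n hk hq hn => ?_⟩
  obtain ⟨j, rfl⟩ : ∃ j, k = j + 3 := ⟨k - 3, by omega⟩
  refine ⟨MonoPath.forcing_nonempty (j := j + 1) (by omega), ?_⟩
  obtain _ | m := j
  · refine div_le_self (Nat.cast_nonneg _) ?_
    have h : 1 ≤ n ^ q := Nat.one_le_pow _ _ (by omega)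
    have h' : (1 : ℝ) ≤ (n : ℝ) ^ q := by exact_mod_cast h
    linarith
  · exact MonoPath.tower_le_ramseyN hq hn
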